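/- Let $E$ be a nonzero real Banach space with dual $E^*$ and bidual $E^{**}$; for $s\in E$ let $\widehat s\in E^{**}$ be its canonical image. Put $q(x,x^*):=\langle x,x^*\rangle$ on $E\times E^*$ and $\widetilde q(x^{**},x^*):=\langle x^*,x^{**}\rangle$ on $E^{**}\times E^*$. Let $\mathcal{PC}(E\times E^*)$ be the set of convex functions $f\colon E\times E^*\to\,]{-}\infty,\infty]$ that are not identically $\infty$, and $\mathcal{PCLSC}(E\times E^*)$ the set of those that are (norm-)lower semicontinuous. For $f\in\mathcal{PC}(E\times E^*)$ let $$f^*(x^{**},x^*):=\sup_{(y,y^*)\in E\times E^*}\big[\langle y,x^*\rangle+\langle y^*,x^{**}\rangle-f(y,y^*)\big]\qquad((x^{**},x^*)\in E^{**}\times E^*),$$ and, if $f\ge q$ on $E\times E^*$, let $\mathcal M f:=\{(x,x^*)\in E\times E^*: f(x,x^*)=\langle x,x^*\rangle\}$. For $\tau>0$ consider the norms $\|(x,x^*)\|_{1,\tau}:=\frac1{\sqrt2}(\tau\|x\|+\|x^*\|/\tau)$, $\|(x,x^*)\|_{2,\tau}:=\sqrt{\tau^2\|x\|^2+\|x^*\|^2/\tau^2}$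 and $\|(x,x^*)\|_{\infty,\tau}:=\sqrt2\max(\tau\|x\|,\|x^*\|/\tau)$ on $E\times E^*$; these are the *special norms*. A function $f\in\mathcal{PC}(E\times E^*)$ is a *VZ function with respect to* a special norm $\|\cdot\|$ if, with $p:=\frac12\|\cdot\|^2+q$, $$\inf_{b\in E\times E^*}\big[(f-q)(b)+p(c-b)\big]=0\quad\text{for all }c\in E\times E^*$$ (which implies $f\ge q$). "VZ function" below may be read either as "VZ function with respect to some special norm" or as "VZ function with respect to every special norm": both readings of each of (e), (f), (g) are among the equivalent conditions. A set $A\subset E\times E^*$ is *monotone* if $\langle x-y,x^*-y^*\rangle\ge0$ for all $(x,x^*),(y,y^*)\in A$, and *maximally monotone* if it is monotone and not properly contained in another monotone set. Let $A\subset E\times E^*$ be maximally monotone and put $$\Theta_A(x^{**},x^*):=\sup_{(s,s^*)\in A}\big[\langle s,x^*\rangle+\langle s^*,x^{**}\rangle-\langle s,s^*\rangle\big]\quad\text{on }E^{**}\times E^*,$$ $$\Phi_A(x,x^*):=\sup_{(s,s^*)\in A}\big[\langle x,s^*\rangle+\langle s,x^*\rangle-\langle s,s^*\rangle\big]\quad\text{on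 }E\times E^*,$$ $${}^*\Theta_A(y,y^*):=\sup_{(x^{**},x^*)\in E^{**}\times E^*}\big[\langle y,x^*\rangle+\langle y^*,x^{**}\rangle-\Theta_A(x^{**},x^*)\big]\quad\text{on }E\times E^*.$$ **Theorem 5.8.** The following conditions are equivalent: (a) $A$ is of type (NI): $\inf_{(s,s^*)\in A}\langle x^*-s^*,x^{**}-\widehat s\rangle\le0$ for all $(x^{**},x^*)\in E^{**}\times E^*$. (b) $\Theta_A\ge\widetilde q$ on $E^{**}\times E^*$. (c) $\Phi_A{}^*\ge\widetilde q$ on $E^{**}\times E^*$. (d) $A$ is strongly representable: there is $f\in\mathcal{PCLSC}(E\times E^*)$ with $f\ge q$ on $E\times E^*$, $f^*\ge\widetilde q$ on $E^{**}\times E^*$ and $\mathcal M f=A$. (e) There is a lower semicontinuous VZ function $f$ on $E\times E^*$ with $\mathcal M f=A$. (f) $\Phi_A$ is a VZ function. (g) ${}^*\Theta_A$ is a VZ function. (b$_1$) Every $h\in\mathcal{PC}(E\times E^*)$ with ${}^*\Theta_A\ge h$ on $E\times E^*$ satisfies $h^*\ge\widetilde q$ on $E^{**}\times E^*$. (b$_2$)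 Every $h\in\mathcal{PCLSC}(E\times E^*)$ with ${}^*\Theta_A\ge h\ge\Phi_A$ on $E\times E^*$ satisfies $h^*\ge\widetilde q$ on $E^{**}\times E^*$. (c$_1$) There is $h\in\mathcal{PCLSC}(E\times E^*)$ with ${}^*\Theta_A\ge h\ge\Phi_A$ on $E\times E^*$ and $h^*\ge\widetilde q$ on $E^{**}\times E^*$. (c$_2$) There is $h\in\mathcal{PC}(E\times E^*)$ with $h\ge\Phi_A$ on $E\times E^*$ and $h^*\ge\widetilde q$ on $E^{**}\times E^*$. In particular, a maximally monotone set is strongly representable if and only if it is of type (NI). -/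

import Mathlib

open Set

noncomputable section

namespace SSD

/-! ### Extended-real-valued functions -/

section General

variable {X : Type*} [AddCommGroup X] [Module ℝ X]

/-- `PC(X)`: proper convex functions `X → ]-∞, ∞]`, i.e. extended-real-valued functions which
never take the value `-∞`, are not identically `∞`, and are convex. -/
structure IsProperConvex (f : X → EReal) : Prop where
  ne_bot : ∀ x, f x ≠ ⊥
  proper : ∃ x, f x ≠ ⊤
  convex : ∀ x y : X, ∀ s t : ℝ, 0 < s → 0 < t → s + t = 1 →
    f (s • x + t • y) ≤ (s : EReal) * f x + (t : EReal) * f y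

/-- `PCLSC(X)`: lower semicontinuous members of `PC(X)`. -/
structure IsProperConvexLSC [TopologicalSpace X] (f : X → EReal) : Prop
    extends IsProperConvex f where
  lsc : LowerSemicontinuous f

/-- The inf-convolution `(h ∇ k)(x) = inf_y [h(y) + k(x - y)]`. -/
def infConv (h k : X → EReal) (x : X) : EReal :=
  ⨅ y : X, (h y + k (x - y))

end General

/-! ### The space `E × E*` and its dual `E** × E*` -/

variable {E : Type*} [NormedAddCommGroup E] [NormedSpace ℝ E]

/-- The duality pairing of `(y, y*) ∈ E × E*` and `(x**, x*) ∈ E** × E*`: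
`⟨y, x*⟩ + ⟨y*, x**⟩`. -/
def pairing (b : E × StrongDual ℝ E) (c : StrongDual ℝ (StrongDual ℝ E) × StrongDual ℝ E) : ℝ :=
  c.2 b.1 + c.1 b.2

/-- `q(x, x*) = ⟨x, x*⟩` on `E × E*`. -/
def q (b : E × StrongDual ℝ E) : ℝ := b.2 b.1

/-- `q̃(x**, x*) = ⟨x*, x**⟩` on `E** × E*`. -/
def qTilde (c : StrongDual ℝ (StrongDual ℝ E) × StrongDual ℝ E) : ℝ := c.1 c.2

/-- The embedding `ι(x, x*) = (x̂, x*)` of `E × E*` in `E** × E*`. -/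
def iota (b : E × StrongDual ℝ E) : StrongDual ℝ (StrongDual ℝ E) × StrongDual ℝ E :=
  (NormedSpace.inclusionInDoubleDual ℝ E b.1, b.2)

/-- Monotone subsets of `E × E*`: `⟨x - y, x* - y*⟩ ≥ 0` for all `(x, x*)`, `(y, y*)` in `A`. -/
def IsMonotoneSet (A : Set (E × StrongDual ℝ E)) : Prop :=
  ∀ b ∈ A, ∀ c ∈ A, 0 ≤ (b.2 - c.2) (b.1 - c.1)

/-- Maximally monotone subsets of `E × E*`: maximal, for inclusion, among the monotone subsets. -/
def IsMaximallyMonotone (A : Set (E × StrongDual ℝ E)) : Prop :=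
  Maximal IsMonotoneSet A

/-- The Fenchel conjugate `f* : E** × E* → [-∞, ∞]` of `f` on `E × E*`. -/
def conj (f : E × StrongDual ℝ E → EReal)
    (c : StrongDual ℝ (StrongDual ℝ E) × StrongDual ℝ E) : EReal :=
  ⨆ b : E × StrongDual ℝ E, ((pairing b c : ℝ) : EReal) - f b

/-- `Θ_A(x**, x*) = sup_{(s, s*) ∈ A} [⟨s, x*⟩ + ⟨s*, x**⟩ - ⟨s, s*⟩]`. -/
def Theta (A : Set (E × StrongDual ℝ E))
    (c : StrongDual ℝ (StrongDual ℝ E) × StrongDual ℝ E) : EReal :=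
  ⨆ a ∈ A, ((pairing a c - q a : ℝ) : EReal)

/-- The Fitzpatrick function
`Φ_A(x, x*) = sup_{(s, s*) ∈ A} [⟨x, s*⟩ + ⟨s, x*⟩ - ⟨s, s*⟩]`. -/
def Phi (A : Set (E × StrongDual ℝ E)) (b : E × StrongDual ℝ E) : EReal :=
  ⨆ a ∈ A, ((a.2 b.1 + b.2 a.1 - q a : ℝ) : EReal)

/-- `*Θ_A(y, y*) = sup_{(x**, x*) ∈ E** × E*} [⟨y, x*⟩ + ⟨y*, x**⟩ - Θ_A(x**, x*)]`. -/
def starTheta (A : Set (E × StrongDual ℝ E)) (b : E × StrongDual ℝ E) : EReal :=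
  ⨆ c : StrongDual ℝ (StrongDual ℝ E) × StrongDual ℝ E,
    ((pairing b c : ℝ) : EReal) - Theta A c

/-- `M f = {(x, x*) : f(x, x*) = ⟨x, x*⟩}`; used for `f` with `f ≥ q` only. -/
def MSet (f : E × StrongDual ℝ E → EReal) : Set (E × StrongDual ℝ E) :=
  {b | f b = ((q b : ℝ) : EReal)}

/-! ### Special norms and VZ functions -/

/-- `‖(x, x*)‖_{1,τ} = (τ‖x‖ + ‖x*‖/τ) / √2`. -/
def normOne (τ : ℝ) (b : E × StrongDual ℝ E) : ℝ :=
  1 / Real.sqrt 2 * (τ * ‖b.1‖ + ‖b.2‖ / τ)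

/-- `‖(x, x*)‖_{2,τ} = √(τ²‖x‖² + ‖x*‖²/τ²)`. -/
def normTwo (τ : ℝ) (b : E × StrongDual ℝ E) : ℝ :=
  Real.sqrt (τ ^ 2 * ‖b.1‖ ^ 2 + ‖b.2‖ ^ 2 / τ ^ 2)

/-- `‖(x, x*)‖_{∞,τ} = √2 max(τ‖x‖, ‖x*‖/τ)`. -/
def normInfty (τ : ℝ) (b : E × StrongDual ℝ E) : ℝ :=
  Real.sqrt 2 * max (τ * ‖b.1‖) (‖b.2‖ / τ)

/-- The special norms on `E × E*`. -/
def IsSpecialNorm (N : E × StrongDual ℝ E → ℝ) : Prop :=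
  ∃ τ : ℝ, 0 < τ ∧ (N = normOne τ ∨ N = normTwo τ ∨ N = normInfty τ)

/-- `f ∈ PC(E × E*)` is a VZ function with respect to the norm `N` if
`(f - q) ∇ p = 0` on `E × E*`, where `p = N²/2 + q`. -/
def IsVZWith (N : E × StrongDual ℝ E → ℝ) (f : E × StrongDual ℝ E → EReal) : Prop :=
  IsProperConvex f ∧
    ∀ c, infConv (fun b => f b - ((q b : ℝ) : EReal))
      (fun b => ((1 / 2 * N b ^ 2 + q b : ℝ) : EReal)) c = 0

/-- `f` is a VZ function with respect to some special norm. -/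
def IsVZ (f : E × StrongDual ℝ E → EReal) : Prop :=
  ∃ N : E × StrongDual ℝ E → ℝ, IsSpecialNorm N ∧ IsVZWith N f

/-- `f` is a VZ function with respect to every special norm. -/
def IsVZAll (f : E × StrongDual ℝ E → EReal) : Prop :=
  ∀ N : E × StrongDual ℝ E → ℝ, IsSpecialNorm N → IsVZWith N f

/-! ### Type (NI) and strong representability -/

/-- `A` is of type (NI): `inf_{(s, s*) ∈ A} ⟨x* - s*, x** - ŝ⟩ ≤ 0` for all
`(x**, x*) ∈ E** × E*` (infimum in `[-∞, ∞]`). -/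
def IsTypeNI (A : Set (E × StrongDual ℝ E)) : Prop :=
  ∀ c : StrongDual ℝ (StrongDual ℝ E) × StrongDual ℝ E,
    (⨅ a ∈ A, ((qTilde (c - iota a) : ℝ) : EReal)) ≤ 0

/-- `A` is strongly representable: `A = M f` for a lower semicontinuous proper convex `f` with
`f ≥ q` on `E × E*` and `f* ≥ q̃` on `E** × E*`. -/
def IsStronglyRepresentable (A : Set (E × StrongDual ℝ E)) : Prop :=
  ∃ f : E × StrongDual ℝ E → EReal, IsProperConvexLSC f ∧
    (∀ b, ((q b : ℝ) : EReal) ≤ f b) ∧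
    (∀ c, ((qTilde c : ℝ) : EReal) ≤ conj f c) ∧
    MSet f = A

end SSD

end

/-!
Throughout, `B = E × E*`, and `v`, `w` range over `B* = E** × E*`.

Almost everything rests on one characterization: a proper convex `f` on `B` is a VZ function with
respect to some special norm, or to every one, exactly when `f ≥ q` and `f* ≥ q̃`. Expanding
`p (c - b)` turns `(f - q)(b) + p (c - b)` into
`f b - ⟨b, ι c⟩ + q c + N (c - b)² / 2`, which is convex in `b`. If its infimum were positive, an
affine function `b ↦ ⟨b, v⟩ + μ` could be put between `f` and the negative of the remaining terms
(`IsProperConvex.exists_affine_between`); then `f* v ≥ q̃ v` gives `μ ≤ -q̃ v`, contradicting the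
fact that the conjugate of `N² / 2` plus `q̃` is nonnegative (`isVZAll_of_le_of_le_conj`). Conversely,
if `f* v < q̃ v`, one chooses `c` so that `q̃ (v - ι c)` plus the conjugate of `N² / 2` at `v - ι c` is
almost zero, and the infimum at `c` is then positive (`IsVZWith.qTilde_le_conj`). Since the special
norms with parameter `τ` lie between the first and the third one, only these two matter.

This settles the equivalences between the VZ conditions and the conjugate inequalities, together
with `Φ_A ≤ *Θ_A`, `(*Θ_A)* = Θ_A`, the fact that `Φ_A` and `*Θ_A` dominate `q` and coincide with it
exactly on `A`, and `f ≥ Φ_A` for every convex `f ≥ q` whose coincidence set is `A`.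

What remains is to deduce type (NI) from `Φ_A* ≥ q̃`, and here completeness of `E` is used. Now
`f = Φ_A` is a lower semicontinuous VZ function with `M f = A`. Near every point where `f - q` is
small there is a point of `M f` (`IsVZWith.exists_mem_MSet_norm_sub_le`); hence
`inf_{a ∈ M f} p (c - a) = 0` for all `c` (`IsVZWith.exists_mem_MSet_norm_sq_add_q_le`). For `c`
chosen as above for `v`, the identity
`q̃ (v - ι a) = q̃ (v - ι c) + ⟨c - a, v - ι c⟩ + q (c - a)` makes `q̃ (v - ι a)` at most an arbitrarily
small positive number for some `a ∈ A`.
-/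

noncomputable section

namespace SSD

open Filter Topology

/-! ### Extended-real arithmetic against real bounds -/

theorem coe_sub_le_coe_iff {x : EReal} {r s : ℝ} :
    (r : EReal) - x ≤ s ↔ ((r - s : ℝ) : EReal) ≤ x := by
  induction x with
  | bot => simp [-EReal.coe_sub]
  | top => simp
  | coe x => norm_cast; constructor <;> intro h <;> linarith

theorem zero_le_sub_add_iff {x : EReal} {r s : ℝ} :
    0 ≤ x - (r : EReal) + s ↔ ((r - s : ℝ) : EReal) ≤ x := by
  induction x with
  | bot => simp [-EReal.coe_sub]
  | top => simp
  | coe x => norm_cast; constructor <;> intro h <;> linarith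

theorem sub_add_lt_coe_iff {x : EReal} {r s t : ℝ} :
    x - (r : EReal) + s < t ↔ x < ((r - s + t : ℝ) : EReal) := by
  induction x with
  | bot => simp [-EReal.coe_sub, -EReal.coe_add, EReal.bot_lt_coe]
  | top => simp
  | coe x => norm_cast; constructor <;> intro h <;> linarith

theorem coe_le_of_forall_le {x : EReal} {r : ℝ} (hx : x ≠ ⊥)
    (h : ∀ t : ℝ, x ≤ t → r ≤ t) : (r : EReal) ≤ x := by
  induction x with
  | bot => exact absurd rfl hx
  | top => exact le_top
  | coe x => exact_mod_cast h x le_rfl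

/-! ### Convex extended-real functions -/

section Convex

variable {X : Type*} [AddCommGroup X] [Module ℝ X] {f : X → EReal}

theorem IsProperConvex.le_combination (hf : IsProperConvex f) {x y : X} {s t r u : ℝ} (hs : 0 < s)
    (ht : 0 < t) (hst : s + t = 1) (hx : f x ≤ r) (hy : f y ≤ u) :
    f (s • x + t • y) ≤ ((s * r + t * u : ℝ) : EReal) := by
  refine (hf.convex x y s t hs ht hst).trans ?_
  obtain ⟨a, ha⟩ : ∃ a : ℝ, f x = a :=
    ⟨_, (EReal.coe_toReal (ne_top_of_le_ne_top (EReal.coe_ne_top _) hx) (hf.ne_bot x)).symm⟩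
  obtain ⟨b, hb⟩ : ∃ b : ℝ, f y = b :=
    ⟨_, (EReal.coe_toReal (ne_top_of_le_ne_top (EReal.coe_ne_top _) hy) (hf.ne_bot y)).symm⟩
  rw [ha] at hx ⊢
  rw [hb] at hy ⊢
  norm_cast at hx hy ⊢
  gcongr

/-- Convexity only has to be tested on real upper bounds of the values. -/
theorem isProperConvex_of_le_combination (hbot : ∀ x, f x ≠ ⊥) (htop : ∃ x, f x ≠ ⊤)
    (h : ∀ (x y : X) (s t r u : ℝ), 0 < s → 0 < t → s + t = 1 → f x ≤ r → f y ≤ u →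
      f (s • x + t • y) ≤ ((s * r + t * u : ℝ) : EReal)) : IsProperConvex f where
  ne_bot := hbot
  proper := htop
  convex x y s t hs ht hst := by
    have hs' : (s : EReal) * f x ≠ ⊥ := by
      have := hbot x
      induction hx : f x with
      | bot => exact absurd hx this
      | top => simp [EReal.coe_mul_top_of_pos hs]
      | coe a => exact_mod_cast EReal.coe_ne_bot (s * a)
    have ht' : (t : EReal) * f y ≠ ⊥ := by
      have := hbot y
      induction hy : f y with
      | bot => exact absurd hy this
      | top => simp [EReal.coe_mul_top_of_pos ht]
      | coe a => exact_mod_cast EReal.coe_ne_bot (t * a)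
    by_cases hx : f x = ⊤
    · rw [hx, EReal.coe_mul_top_of_pos hs, EReal.top_add_of_ne_bot ht']
      exact le_top
    by_cases hy : f y = ⊤
    · rw [hy, EReal.coe_mul_top_of_pos ht, EReal.add_top_of_ne_bot hs']
      exact le_top
    have := h x y s t _ _ hs ht hst (EReal.le_coe_toReal hx) (EReal.le_coe_toReal hy)
    rwa [EReal.coe_add, EReal.coe_mul, EReal.coe_mul, EReal.coe_toReal hx (hbot x),
      EReal.coe_toReal hy (hbot y)] at this

end Convex

/-- Sandwich theorem: a continuous affine function fits between a continuous concave function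
and a proper convex function above it. -/
theorem IsProperConvex.exists_affine_between {X : Type*} [NormedAddCommGroup X] [NormedSpace ℝ X]
    {f : X → EReal} (hf : IsProperConvex f) {g : X → ℝ} (hg : ConcaveOn ℝ univ g)
    (hgc : Continuous g) (h : ∀ x, (g x : EReal) ≤ f x) :
    ∃ (φ : StrongDual ℝ X) (μ : ℝ),
      (∀ x, ((φ x + μ : ℝ) : EReal) ≤ f x) ∧ ∀ x, g x ≤ φ x + μ := by
  have hC : Convex ℝ {p : X × ℝ | p.2 < g p.1} := by
    simpa using hg.convex_strict_hypograph
  have hCo : IsOpen {p : X × ℝ | p.2 < g p.1} :=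
    isOpen_lt continuous_snd (hgc.comp continuous_fst)
  have hD : Convex ℝ {p : X × ℝ | f p.1 ≤ (p.2 : EReal)} := by
    rw [convex_iff_forall_pos]
    intro p hp r hr s t hs ht hst
    exact hf.le_combination hs ht hst hp hr
  have hdisj : Disjoint {p : X × ℝ | p.2 < g p.1} {p : X × ℝ | f p.1 ≤ (p.2 : EReal)} := by
    rw [Set.disjoint_left]
    intro p hp hp'
    have : g p.1 ≤ p.2 := by exact_mod_cast (h p.1).trans hp'
    exact absurd hp (not_lt.mpr this)
  obtain ⟨F, u, hF₁, hF₂⟩ := geometric_hahn_banach_open hC hCo hD hdisj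
  have hFdec : ∀ x r, F (x, r) = F (x, 0) + r * F (0, 1) := by
    intro x r
    have : ((x, r) : X × ℝ) = (x, 0) + r • (0, 1) := by simp
    rw [this, map_add, map_smul, smul_eq_mul]
  set l := F (0, 1) with hl
  have hlpos : 0 < l := by
    obtain ⟨x, hx⟩ := hf.proper
    have h₂ := hF₂ (x, (f x).toReal) (EReal.le_coe_toReal hx)
    have hgx : g x ≤ (f x).toReal := by
      exact_mod_cast (h x).trans (EReal.le_coe_toReal hx)
    have h₁ := hF₁ (x, g x - 1) (by simp)
    rw [hFdec] at h₁ h₂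
    nlinarith
  refine ⟨(-l⁻¹) • F.comp (ContinuousLinearMap.inl ℝ X ℝ), u / l, fun x => ?_, fun x => ?_⟩
  · refine coe_le_of_forall_le (hf.ne_bot x) fun t ht => ?_
    have h₂ := hF₂ (x, t) ht
    rw [hFdec] at h₂
    have : u / l ≤ (F (x, 0) + t * l) / l := by gcongr
    have e : (F (x, 0) + t * l) / l = l⁻¹ * F (x, 0) + t := by field_simp
    simp
    linarith
  · refine le_of_forall_lt fun r hr => ?_
    have h₁ := hF₁ (x, r) hr
    rw [hFdec] at h₁
    have : (F (x, 0) + r * l) / l < u / l := by gcongr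
    have e : (F (x, 0) + r * l) / l = l⁻¹ * F (x, 0) + r := by field_simp
    simp
    linarith

variable {E : Type*} [NormedAddCommGroup E] [NormedSpace ℝ E]

/-! ### Special norms -/

theorem normOne_sq (τ : ℝ) (b : E × StrongDual ℝ E) :
    normOne τ b ^ 2 = 1 / 2 * (τ * ‖b.1‖ + ‖b.2‖ / τ) ^ 2 := by
  rw [normOne, mul_pow, div_pow, Real.sq_sqrt zero_le_two, one_pow]

theorem normInfty_sq (τ : ℝ) (b : E × StrongDual ℝ E) :
    normInfty τ b ^ 2 = 2 * max (τ * ‖b.1‖) (‖b.2‖ / τ) ^ 2 := by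
  rw [normInfty, mul_pow, Real.sq_sqrt zero_le_two]

theorem isSpecialNorm_normInfty {τ : ℝ} (hτ : 0 < τ) :
    IsSpecialNorm (normInfty τ : E × StrongDual ℝ E → ℝ) :=
  ⟨τ, hτ, Or.inr (Or.inr rfl)⟩

/-- Among the special norms with parameter `τ`, the first is the smallest and the third the
largest. -/
theorem IsSpecialNorm.exists_sq_bounds {N : E × StrongDual ℝ E → ℝ} (hN : IsSpecialNorm N) :
    ∃ τ : ℝ, 0 < τ ∧ ∀ b, normOne τ b ^ 2 ≤ N b ^ 2 ∧ N b ^ 2 ≤ normInfty τ b ^ 2 := by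
  obtain ⟨τ, hτ, hN⟩ := hN
  refine ⟨τ, hτ, fun b => ?_⟩
  have hx : 0 ≤ τ * ‖b.1‖ := by positivity
  have hy : 0 ≤ ‖b.2‖ / τ := by positivity
  have htwo : normTwo τ b ^ 2 = (τ * ‖b.1‖) ^ 2 + (‖b.2‖ / τ) ^ 2 := by
    rw [normTwo, Real.sq_sqrt (by positivity)]
    ring
  have h₁ : normOne τ b ^ 2 ≤ normTwo τ b ^ 2 := by
    rw [normOne_sq, htwo]
    nlinarith [sq_nonneg (τ * ‖b.1‖ - ‖b.2‖ / τ)]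
  have h₂ : normTwo τ b ^ 2 ≤ normInfty τ b ^ 2 := by
    rw [normInfty_sq, htwo]
    have := pow_le_pow_left₀ hx (le_max_left (τ * ‖b.1‖) (‖b.2‖ / τ)) 2
    have := pow_le_pow_left₀ hy (le_max_right (τ * ‖b.1‖) (‖b.2‖ / τ)) 2
    linarith
  rcases hN with rfl | rfl | rfl
  · exact ⟨le_rfl, h₁.trans h₂⟩
  · exact ⟨h₁, h₂⟩
  · exact ⟨h₁.trans h₂, le_rfl⟩

theorem neg_le_apply {V : Type*} [NormedAddCommGroup V] [NormedSpace ℝ V] (φ : StrongDual ℝ V)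
    (x : V) : -(‖φ‖ * ‖x‖) ≤ φ x :=
  (abs_le.1 (φ.le_opNorm x)).1

theorem apply_le_mul {V : Type*} [NormedAddCommGroup V] [NormedSpace ℝ V] (φ : StrongDual ℝ V)
    (x : V) : φ x ≤ ‖φ‖ * ‖x‖ :=
  (abs_le.1 (φ.le_opNorm x)).2

/-- `p = N² / 2 + q` is nonnegative for every special norm `N`. -/
theorem IsSpecialNorm.half_sq_add_q_nonneg {N : E × StrongDual ℝ E → ℝ} (hN : IsSpecialNorm N)
    (b : E × StrongDual ℝ E) : 0 ≤ 1 / 2 * N b ^ 2 + q b := by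
  obtain ⟨τ, hτ, h⟩ := hN.exists_sq_bounds
  have h₁ := (h b).1
  rw [normOne_sq] at h₁
  have h₂ : -(‖b.2‖ * ‖b.1‖) ≤ q b := neg_le_apply b.2 b.1
  have h₃ : τ * ‖b.1‖ * (‖b.2‖ / τ) = ‖b.2‖ * ‖b.1‖ := by field_simp
  nlinarith [sq_nonneg (τ * ‖b.1‖ - ‖b.2‖ / τ)]

/-! ### Almost norm-attaining points -/

theorem exists_apply_le {V : Type*} [NormedAddCommGroup V] [NormedSpace ℝ V] (φ : StrongDual ℝ V)
    {R ε : ℝ} (hR : 0 ≤ R) (hε : 0 < ε) : ∃ x : V, ‖x‖ ≤ R ∧ φ x ≤ -(R * ‖φ‖) + ε := by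
  rcases hR.eq_or_lt with rfl | hR
  · exact ⟨0, by simp, by simpa using hε.le⟩
  obtain ⟨x, hx, hφ⟩ := φ.exists_lt_apply_of_lt_opNorm (r := ‖φ‖ - ε / R)
    (by have : 0 < ε / R := by positivity
        linarith)
  have key : ∃ y : V, ‖y‖ < 1 ∧ φ y = -‖φ x‖ := by
    rcases abs_cases (φ x) with ⟨h, -⟩ | ⟨h, -⟩
    · exact ⟨-x, by simpa using hx, by rw [map_neg, Real.norm_eq_abs, h]⟩
    · exact ⟨x, hx, by rw [Real.norm_eq_abs, h, neg_neg]⟩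
  obtain ⟨y, hy, hφy⟩ := key
  refine ⟨R • y, ?_, ?_⟩
  · rw [norm_smul, Real.norm_of_nonneg hR.le]
    nlinarith
  · rw [map_smul, smul_eq_mul, hφy]
    have : R * (‖φ‖ - ε / R) ≤ R * ‖φ x‖ := by gcongr
    have e : R * (‖φ‖ - ε / R) = R * ‖φ‖ - ε := by field_simp
    linarith

/-- The conjugate of half the square of the largest special norm, taken at `-w`, is at least
`-q̃ w`; the supremum defining it is here approximated within `ε`. -/
theorem exists_pairing_add_normInfty_le (w : StrongDual ℝ (StrongDual ℝ E) × StrongDual ℝ E)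
    {τ ε : ℝ} (hτ : 0 < τ) (hε : 0 < ε) :
    ∃ d : E × StrongDual ℝ E, pairing d w + 1 / 2 * normInfty τ d ^ 2 ≤ qTilde w + ε := by
  set α := ‖w.2‖ / τ with hα
  set β := τ * ‖w.1‖ with hβ
  have hα₀ : 0 ≤ α := by positivity
  have hβ₀ : 0 ≤ β := by positivity
  obtain ⟨x, hx, hx'⟩ := exists_apply_le w.2 (R := (α + β) / 2 / τ) (ε := ε / 2) (by positivity)
    (by positivity)
  obtain ⟨y, hy, hy'⟩ := exists_apply_le w.1 (R := τ * ((α + β) / 2)) (ε := ε / 2) (by positivity)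
    (by positivity)
  refine ⟨(x, y), ?_⟩
  have hm : max (τ * ‖x‖) (‖y‖ / τ) ≤ (α + β) / 2 := by
    refine max_le ?_ ?_
    · rw [le_div_iff₀ hτ] at hx
      linarith
    · rw [div_le_iff₀ hτ]
      linarith
  have hm₀ : 0 ≤ max (τ * ‖x‖) (‖y‖ / τ) := le_max_of_le_left (by positivity)
  have hm₂ := pow_le_pow_left₀ hm₀ hm 2
  have hq : -(‖w.1‖ * ‖w.2‖) ≤ qTilde w := neg_le_apply w.1 w.2
  have e₁ : (α + β) / 2 / τ * ‖w.2‖ = (α + β) / 2 * α := by rw [hα]; ring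
  have e₂ : τ * ((α + β) / 2) * ‖w.1‖ = (α + β) / 2 * β := by rw [hβ]; ring
  have e₃ : ‖w.1‖ * ‖w.2‖ = α * β := by rw [hα, hβ]; field_simp
  rw [e₁] at hx'
  rw [e₂] at hy'
  rw [e₃] at hq
  rw [normInfty_sq]
  simp only [pairing]
  nlinarith [sq_nonneg (α - β)]

/-- Every `v ∈ E** × E*` is the sum of some `ι c` and some `w` whose components have balanced
norms and for which `q̃ w` is almost as negative as these norms permit. -/
theorem exists_qTilde_sub_iota_le (v : StrongDual ℝ (StrongDual ℝ E) × StrongDual ℝ E)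
    {τ ε : ℝ} (hτ : 0 < τ) (hε : 0 < ε) :
    ∃ (c : E × StrongDual ℝ E) (β : ℝ), 0 ≤ β ∧ ‖(v - iota c).1‖ ≤ β / τ ∧
      ‖(v - iota c).2‖ ≤ τ * β ∧ qTilde (v - iota c) ≤ -β ^ 2 + ε := by
  obtain ⟨y, hy, hy'⟩ := exists_apply_le v.1 (R := τ * (τ * ‖v.1‖)) (by positivity) hε
  have h₁ : (v - iota (0, v.2 - y)).1 = v.1 := by
    ext
    simp [iota]
  have h₂ : (v - iota (0, v.2 - y)).2 = y := sub_sub_cancel v.2 y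
  refine ⟨(0, v.2 - y), τ * ‖v.1‖, by positivity, ?_, ?_, ?_⟩
  · rw [h₁, mul_div_cancel_left₀ _ hτ.ne']
  · rwa [h₂]
  · rw [qTilde, h₁, h₂]
    linarith

/-! ### Algebra of the pairing -/

theorem pairing_sub_iota (b c : E × StrongDual ℝ E)
    (v : StrongDual ℝ (StrongDual ℝ E) × StrongDual ℝ E) :
    pairing (b - c) (v - iota c) =
      pairing b v - pairing c v - pairing b (iota c) + 2 * q c := by
  simp [pairing, iota, q]
  ring

theorem qTilde_sub_iota (c : E × StrongDual ℝ E)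
    (v : StrongDual ℝ (StrongDual ℝ E) × StrongDual ℝ E) :
    qTilde (v - iota c) = qTilde v - pairing c v + q c := by
  simp [pairing, iota, q, qTilde]
  ring

theorem q_sub (b c : E × StrongDual ℝ E) : q (b - c) = q b - pairing b (iota c) + q c := by
  simp [pairing, iota, q]
  ring

theorem pairing_iota_comm (b c : E × StrongDual ℝ E) :
    pairing b (iota c) = pairing c (iota b) := by
  simp [pairing, iota]
  ring

theorem q_combination (b c : E × StrongDual ℝ E) (s t : ℝ) :
    q (s • b + t • c) = s ^ 2 * q b + s * t * pairing b (iota c) + t ^ 2 * q c := by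
  simp [pairing, iota, q]
  ring

theorem q_neg (b : E × StrongDual ℝ E) : q (-b) = q b := by simp [q]

/-! ### VZ functions and the conjugate inequality -/

theorem isVZWith_iff {N : E × StrongDual ℝ E → ℝ} {f : E × StrongDual ℝ E → EReal} :
    IsVZWith N f ↔ IsProperConvex f ∧ ∀ c,
      (∀ b, ((q b - (1 / 2 * N (c - b) ^ 2 + q (c - b)) : ℝ) : EReal) ≤ f b) ∧
      ∀ ε : ℝ, 0 < ε →
        ∃ b, f b < ((q b - (1 / 2 * N (c - b) ^ 2 + q (c - b)) + ε : ℝ) : EReal) := by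
  refine and_congr_right fun _ => forall_congr' fun c => ?_
  simp only [infConv, le_antisymm_iff (b := (0 : EReal)), le_iInf_iff, zero_le_sub_add_iff]
  rw [and_comm]
  refine and_congr_right fun _ => ⟨fun h ε hε => ?_, fun h => ?_⟩
  · obtain ⟨b, hb⟩ := iInf_lt_iff.1 (h.trans_lt (EReal.coe_pos.2 hε))
    exact ⟨b, sub_add_lt_coe_iff.1 hb⟩
  · refine EReal.le_of_forall_lt_iff_le.1 fun ε hε => ?_
    obtain ⟨b, hb⟩ := h ε (EReal.coe_pos.1 hε)
    exact iInf_le_of_le b (sub_add_lt_coe_iff.2 hb).le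

theorem conj_le_coe_iff {f : E × StrongDual ℝ E → EReal}
    {v : StrongDual ℝ (StrongDual ℝ E) × StrongDual ℝ E} {r : ℝ} :
    conj f v ≤ r ↔ ∀ b, ((pairing b v - r : ℝ) : EReal) ≤ f b := by
  simp only [conj, iSup_le_iff, coe_sub_le_coe_iff]

theorem IsVZWith.q_le {N : E × StrongDual ℝ E → ℝ} (hN : IsSpecialNorm N)
    {f : E × StrongDual ℝ E → EReal} (hf : IsVZWith N f) (b : E × StrongDual ℝ E) :
    ((q b : ℝ) : EReal) ≤ f b := by
  have h₁ := ((isVZWith_iff.1 hf).2 b).1 b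
  have h₂ : N 0 = 0 := by
    obtain ⟨τ, -, rfl | rfl | rfl⟩ := hN <;> simp [normOne, normTwo, normInfty]
  simpa [h₂, q] using h₁

/-- The conjugate of a VZ function dominates `q̃`: an affine minorant violating this at `v` would
stay strictly above the infimum defining `(f - q) ∇ p` at a point `c` with `q̃ (v - ι c)` nearly as
negative as possible. -/
theorem IsVZWith.qTilde_le_conj {N : E × StrongDual ℝ E → ℝ} (hN : IsSpecialNorm N)
    {f : E × StrongDual ℝ E → EReal} (hf : IsVZWith N f)
    (v : StrongDual ℝ (StrongDual ℝ E) × StrongDual ℝ E) :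
    ((qTilde v : ℝ) : EReal) ≤ conj f v := by
  by_contra! hlt
  obtain ⟨r, hr, hr'⟩ := EReal.lt_iff_exists_real_btwn.1 hlt
  have hrq : r < qTilde v := by exact_mod_cast hr'
  obtain ⟨τ, hτ, hbd⟩ := hN.exists_sq_bounds
  obtain ⟨c, β, hβ, hw₁, hw₂, hq⟩ := exists_qTilde_sub_iota_le v (ε := (qTilde v - r) / 2) hτ
    (by linarith)
  obtain ⟨b, hb⟩ := ((isVZWith_iff.1 hf).2 c).2 ((qTilde v - r) / 2) (by linarith)
  have hb₁ : pairing b v - r < q b - (1 / 2 * N (c - b) ^ 2 + q (c - b)) + (qTilde v - r) / 2 := by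
    exact_mod_cast (conj_le_coe_iff.1 hr.le b).trans_lt hb
  have hb₂ := (hbd (c - b)).1
  have hb₃ : -((τ * ‖(c - b).1‖ + ‖(c - b).2‖ / τ) * β) ≤ pairing (b - c) (v - iota c) := by
    have h₁ := neg_le_apply (v - iota c).2 (b - c).1
    have h₂ := neg_le_apply (v - iota c).1 (b - c).2
    have h₃ : ‖(v - iota c).2‖ * ‖(b - c).1‖ ≤ τ * β * ‖(b - c).1‖ := by gcongr
    have h₄ : ‖(v - iota c).1‖ * ‖(b - c).2‖ ≤ β / τ * ‖(b - c).2‖ := by gcongr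
    have e₁ : ‖(c - b).1‖ = ‖(b - c).1‖ := norm_sub_rev _ _
    have e₂ : ‖(c - b).2‖ = ‖(b - c).2‖ := norm_sub_rev _ _
    have e₃ : (τ * ‖(b - c).1‖ + ‖(b - c).2‖ / τ) * β =
        τ * β * ‖(b - c).1‖ + β / τ * ‖(b - c).2‖ := by ring
    rw [e₁, e₂, e₃, pairing]
    linarith
  rw [normOne_sq] at hb₂
  rw [pairing_sub_iota] at hb₃
  rw [qTilde_sub_iota] at hq
  rw [q_sub, pairing_iota_comm] at hb₁
  nlinarith [sq_nonneg ((τ * ‖(c - b).1‖ + ‖(c - b).2‖ / τ) - 2 * β)]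

theorem convexOn_half_normInfty_sq {τ : ℝ} (hτ : 0 < τ) :
    ConvexOn ℝ univ fun b : E × StrongDual ℝ E => 1 / 2 * normInfty τ b ^ 2 := by
  have h₁ : ConvexOn ℝ univ fun b : E × StrongDual ℝ E => τ * ‖b.1‖ :=
    ((convexOn_univ_norm (E := E)).comp_linearMap (LinearMap.fst ℝ E (StrongDual ℝ E))).smul hτ.le
  have h₂ : ConvexOn ℝ univ fun b : E × StrongDual ℝ E => ‖b.2‖ / τ := by
    have := ((convexOn_univ_norm (E := StrongDual ℝ E)).comp_linearMap
      (LinearMap.snd ℝ E (StrongDual ℝ E))).smul (inv_nonneg.2 hτ.le)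
    refine this.congr fun b _ => ?_
    simp [div_eq_inv_mul]
  have h₃ := (h₁.sup h₂).pow (n := 2) fun b _ => le_max_of_le_left (by positivity)
  refine h₃.congr fun b _ => ?_
  simp only [normInfty_sq, Pi.pow_apply, Pi.sup_apply]
  ring

theorem concaveOn_pairing_sub_half_normInfty_sq {τ : ℝ} (hτ : 0 < τ) (c : E × StrongDual ℝ E)
    (r : ℝ) :
    ConcaveOn ℝ univ fun b : E × StrongDual ℝ E =>
      pairing b (iota c) + r - 1 / 2 * normInfty τ (b - c) ^ 2 := by
  have h := (convexOn_half_normInfty_sq (E := E) hτ).2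
  refine ⟨convex_univ, fun x _ y _ s t hs ht hst => ?_⟩
  have hxy := h (mem_univ (x - c)) (mem_univ (y - c)) hs ht hst
  have e₁ : s • (x - c) + t • (y - c) = s • x + t • y - c := by
    rw [smul_sub, smul_sub, sub_add_sub_comm, ← add_smul, hst, one_smul]
  have e₂ : pairing (s • x + t • y) (iota c) =
      s * pairing x (iota c) + t * pairing y (iota c) := by
    simp [pairing, iota]
    ring
  rw [e₁] at hxy
  simp only [smul_eq_mul, e₂] at hxy ⊢
  linear_combination hxy + r * hst

theorem continuous_q : Continuous (q : E × StrongDual ℝ E → ℝ) := by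
  unfold q
  fun_prop

theorem continuous_pairing_left (v : StrongDual ℝ (StrongDual ℝ E) × StrongDual ℝ E) :
    Continuous fun b : E × StrongDual ℝ E => pairing b v := by
  unfold pairing
  fun_prop

/-- A convex `f ≥ q` with `f* ≥ q̃` is a VZ function with respect to every special norm. This is
Fenchel duality for `f` and a translate of half the square of the largest special norm. -/
theorem isVZAll_of_le_of_le_conj {f : E × StrongDual ℝ E → EReal} (hf : IsProperConvex f)
    (hq : ∀ b, ((q b : ℝ) : EReal) ≤ f b) (hc : ∀ v, ((qTilde v : ℝ) : EReal) ≤ conj f v) :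
    IsVZAll f := by
  intro N hN
  refine isVZWith_iff.2 ⟨hf, fun c => ⟨fun b => ?_, fun ε hε => ?_⟩⟩
  · refine le_trans ?_ (hq b)
    have := hN.half_sq_add_q_nonneg (c - b)
    exact_mod_cast by linarith
  obtain ⟨τ, hτ, hbd⟩ := hN.exists_sq_bounds
  by_contra! hcon
  have hg : ∀ b, ((pairing b (iota c) + (ε - q c) - 1 / 2 * normInfty τ (b - c) ^ 2 : ℝ) : EReal)
      ≤ f b := by
    intro b
    refine le_trans ?_ (hcon b)
    have h₁ := (hbd (c - b)).2
    have h₂ : normInfty τ (c - b) = normInfty τ (b - c) := by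
      simp [normInfty, norm_sub_rev]
    rw [h₂] at h₁
    have h₃ := q_sub c b
    rw [pairing_iota_comm] at h₃
    exact_mod_cast by linarith
  have hcont : Continuous fun b : E × StrongDual ℝ E =>
      pairing b (iota c) + (ε - q c) - 1 / 2 * normInfty τ (b - c) ^ 2 := by
    have := continuous_pairing_left (iota c)
    unfold normInfty
    fun_prop
  obtain ⟨φ, μ, h₁, h₂⟩ := hf.exists_affine_between
    (concaveOn_pairing_sub_half_normInfty_sq hτ c (ε - q c)) hcont hg
  set v : StrongDual ℝ (StrongDual ℝ E) × StrongDual ℝ E :=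
    (φ.comp (ContinuousLinearMap.inr ℝ E (StrongDual ℝ E)),
      φ.comp (ContinuousLinearMap.inl ℝ E (StrongDual ℝ E))) with hv
  have hφ : ∀ b, φ b = pairing b v := by
    intro b
    simp only [pairing, hv, ContinuousLinearMap.comp_apply, ContinuousLinearMap.inl_apply,
      ContinuousLinearMap.inr_apply, ← map_add]
    simp
  simp only [hφ] at h₁ h₂
  have hμ : qTilde v ≤ -μ := by
    have : conj f v ≤ ((-μ : ℝ) : EReal) := conj_le_coe_iff.2 fun b => by
      simpa only [sub_neg_eq_add] using h₁ b
    exact_mod_cast (hc v).trans this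
  obtain ⟨d, hd⟩ := exists_pairing_add_normInfty_le (v - iota c) hτ (half_pos hε)
  have h₃ := h₂ (c + d)
  have h₄ := pairing_sub_iota (c + d) c v
  rw [add_sub_cancel_left] at h₃ h₄
  rw [qTilde_sub_iota] at hd
  linarith

theorem IsVZAll.isVZ {f : E × StrongDual ℝ E → EReal} (hf : IsVZAll f) : IsVZ f :=
  ⟨_, isSpecialNorm_normInfty one_pos, hf _ (isSpecialNorm_normInfty one_pos)⟩

/-! ### Density of the coincidence set of a lower semicontinuous VZ function -/

theorem normInfty_one_sq (b : E × StrongDual ℝ E) : normInfty 1 b ^ 2 = 2 * ‖b‖ ^ 2 := by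
  rw [normInfty_sq, one_mul, div_one, Prod.norm_def]

theorem abs_pairing_iota_le (b c : E × StrongDual ℝ E) :
    |pairing b (iota c)| ≤ 2 * ‖b‖ * ‖c‖ := by
  have h₁ : |c.2 b.1| ≤ ‖c‖ * ‖b‖ := (c.2.le_opNorm b.1).trans
    (mul_le_mul (norm_snd_le c) (norm_fst_le b) (norm_nonneg _) (norm_nonneg _))
  have h₂ : |b.2 c.1| ≤ ‖b‖ * ‖c‖ := (b.2.le_opNorm c.1).trans
    (mul_le_mul (norm_snd_le b) (norm_fst_le c) (norm_nonneg _) (norm_nonneg _))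
  have h₃ : pairing b (iota c) = c.2 b.1 + b.2 c.1 := by simp [pairing, iota]
  rw [h₃]
  linarith [abs_add_le (c.2 b.1) (b.2 c.1)]

theorem abs_q_le (b : E × StrongDual ℝ E) : |q b| ≤ ‖b‖ ^ 2 := by
  rw [sq]
  exact (b.2.le_opNorm b.1).trans
    (mul_le_mul (norm_snd_le b) (norm_fst_le b) (norm_nonneg _) (norm_nonneg _))

/-- A convex function above `q` cannot be close to `q` at two points between which `q` is very
negative, as the midpoint shows. -/
theorem IsProperConvex.neg_q_sub_le {f : E × StrongDual ℝ E → EReal} (hf : IsProperConvex f)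
    (hq : ∀ b, ((q b : ℝ) : EReal) ≤ f b) {b c : E × StrongDual ℝ E} {r s : ℝ}
    (hb : f b ≤ ((q b + r : ℝ) : EReal)) (hc : f c ≤ ((q c + s : ℝ) : EReal)) :
    -q (b - c) ≤ 2 * r + 2 * s := by
  have h := (hq _).trans
    (hf.le_combination (s := 1 / 2) (t := 1 / 2) one_half_pos one_half_pos (add_halves 1) hb hc)
  rw [EReal.coe_le_coe_iff, q_combination] at h
  rw [q_sub]
  linarith

/-- Where a lower semicontinuous VZ function is close to `q`, there is a nearby point at which it
equals `q`: the VZ property lets one halve the square root of the gap by a step of comparable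
length, and the steps add up by completeness. -/
theorem IsVZWith.exists_mem_MSet_norm_sub_le [CompleteSpace E] {f : E × StrongDual ℝ E → EReal}
    (hf : IsVZWith (normInfty 1) f) (hlsc : LowerSemicontinuous f) {b : E × StrongDual ℝ E} {e : ℝ}
    (he : 0 < e) (hb : f b ≤ ((q b + e ^ 2 : ℝ) : EReal)) : ∃ a ∈ MSet f, ‖a - b‖ ≤ 4 * e := by
  have hq := hf.q_le (isSpecialNorm_normInfty one_pos)
  have step : ∀ (b : E × StrongDual ℝ E) (e : ℝ), 0 < e → f b ≤ ((q b + e ^ 2 : ℝ) : EReal) →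
      ∃ d, f d ≤ ((q d + (e / 2) ^ 2 : ℝ) : EReal) ∧ dist b d ≤ 2 * e := by
    intro b e he hb
    obtain ⟨d, hd⟩ := ((isVZWith_iff.1 hf).2 b).2 ((e / 2) ^ 2) (by positivity)
    have hp := (isSpecialNorm_normInfty one_pos).half_sq_add_q_nonneg (b - d)
    have hd₁ : f d ≤ ((q d + (e / 2) ^ 2 : ℝ) : EReal) :=
      hd.le.trans (by exact_mod_cast by linarith)
    refine ⟨d, hd₁, ?_⟩
    have h₁ := hf.1.neg_q_sub_le hq hb hd₁
    have h₂ : q d < q d - (1 / 2 * normInfty 1 (b - d) ^ 2 + q (b - d)) + (e / 2) ^ 2 := by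
      exact_mod_cast (hq d).trans_lt hd
    rw [normInfty_one_sq] at h₂
    rw [dist_eq_norm]
    exact abs_le_of_sq_le_sq' (by nlinarith) (by positivity) |>.2
  have step' : ∀ p : {p : (E × StrongDual ℝ E) × ℝ //
      0 < p.2 ∧ f p.1 ≤ ((q p.1 + p.2 ^ 2 : ℝ) : EReal)},
      ∃ d, f d ≤ ((q d + (p.1.2 / 2) ^ 2 : ℝ) : EReal) ∧ dist p.1.1 d ≤ 2 * p.1.2 :=
    fun p => step p.1.1 p.1.2 p.2.1 p.2.2
  choose next hnext hdist using step'
  let u : ℕ → {p : (E × StrongDual ℝ E) × ℝ //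
      0 < p.2 ∧ f p.1 ≤ ((q p.1 + p.2 ^ 2 : ℝ) : EReal)} := fun n =>
    Nat.rec ⟨(b, e), he, hb⟩ (fun _ p => ⟨(next p, p.1.2 / 2), half_pos p.2.1, hnext p⟩) n
  have hu₂ : ∀ n, (u n).1.2 = e / 2 ^ n := by
    intro n
    induction n with
    | zero => simp [u]
    | succ n ih =>
      have : (u (n + 1)).1.2 = (u n).1.2 / 2 := rfl
      rw [this, ih, pow_succ, div_div]
  have hud : ∀ n, dist (u n).1.1 (u (n + 1)).1.1 ≤ 4 * e / 2 / 2 ^ n := by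
    intro n
    have h := hdist (u n)
    rw [hu₂] at h
    have e₁ : 4 * e / 2 / 2 ^ n = 2 * (e / 2 ^ n) := by ring
    rw [e₁]
    exact h
  obtain ⟨a, ha⟩ := cauchySeq_tendsto_of_complete (cauchySeq_of_le_geometric_two hud)
  refine ⟨a, ?_, ?_⟩
  · refine le_antisymm ?_ (hq a)
    have hlim : Tendsto (fun n => q (u n).1.1 + (u n).1.2 ^ 2) atTop (𝓝 (q a)) := by
      have h₁ : Tendsto (fun n => (u n).1.2) atTop (𝓝 0) := by
        simp only [hu₂]
        exact tendsto_const_nhds.div_atTop (tendsto_pow_atTop_atTop_of_one_lt one_lt_two)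
      simpa using ((continuous_q.tendsto a).comp ha).add (h₁.pow 2)
    have hclosed := hlsc.isClosed_epigraph.mem_of_tendsto
      (ha.prodMk_nhds ((continuous_coe_real_ereal.tendsto (q a)).comp hlim))
      (Eventually.of_forall fun n => (u n).2.2)
    exact hclosed
  · have := dist_le_of_le_geometric_two_of_tendsto₀ hud ha
    rw [← dist_eq_norm, dist_comm]
    exact this

/-- The infimum defining the VZ property is already zero over the points where `f` equals `q`. -/
theorem IsVZWith.exists_mem_MSet_norm_sq_add_q_le [CompleteSpace E]
    {f : E × StrongDual ℝ E → EReal} (hf : IsVZWith (normInfty 1) f) (hlsc : LowerSemicontinuous f)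
    (c : E × StrongDual ℝ E) {ε : ℝ} (hε : 0 < ε) :
    ∃ a ∈ MSet f, ‖c - a‖ ^ 2 + q (c - a) ≤ ε := by
  have hq := hf.q_le (isSpecialNorm_normInfty one_pos)
  obtain ⟨o, ho⟩ := hf.1.proper
  obtain ⟨r, hr₀, hr⟩ : ∃ r : ℝ, 0 ≤ r ∧ f o ≤ ((q o + r : ℝ) : EReal) := by
    refine ⟨(f o).toReal - q o, ?_, ?_⟩
    · have : q o ≤ (f o).toReal := by exact_mod_cast (hq o).trans (EReal.le_coe_toReal ho)
      linarith
    · rw [add_sub_cancel]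
      exact EReal.le_coe_toReal ho
  -- `R` bounds `‖c - b‖` for all `b` that are nearly optimal at `c`
  set R : ℝ := ‖c - o‖ + (3 + 2 * ‖c - o‖ ^ 2 + 2 * r) + 1 with hR
  have hR₀ : 0 ≤ R := by positivity
  set e : ℝ := min 1 (ε / (33 + 16 * R)) with he
  have he₀ : 0 < e := lt_min one_pos (by positivity)
  have he₁ : e ≤ 1 := min_le_left _ _
  have he₂ : e * (33 + 16 * R) ≤ ε := by
    rw [← le_div_iff₀ (by positivity)]
    exact min_le_right _ _
  obtain ⟨b, hb⟩ := ((isVZWith_iff.1 hf).2 c).2 (e ^ 2) (by positivity)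
  have hp := (isSpecialNorm_normInfty one_pos).half_sq_add_q_nonneg (c - b)
  have hb₁ : f b ≤ ((q b + e ^ 2 : ℝ) : EReal) :=
    hb.le.trans (by exact_mod_cast by linarith)
  have hb₂ : q b < q b - (1 / 2 * normInfty 1 (c - b) ^ 2 + q (c - b)) + e ^ 2 := by
    exact_mod_cast (hq b).trans_lt hb
  rw [normInfty_one_sq] at hb₂
  have he₃ : e ^ 2 ≤ e := by nlinarith
  have hbR : ‖c - b‖ ≤ R := by
    have h₁ := hf.1.neg_q_sub_le hq hb₁ hr
    have h₂ : q (c - b) = -q (c - o) + pairing (c - b) (iota (c - o)) + q (b - o) := by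
      simp [pairing, iota, q]
      ring
    have h₃ := neg_abs_le (pairing (c - b) (iota (c - o)))
    have h₄ := abs_pairing_iota_le (c - b) (c - o)
    have h₅ := (le_abs_self _).trans (abs_q_le (c - o))
    have h₆ : (‖c - b‖ - ‖c - o‖) ^ 2 ≤ 3 + 2 * ‖c - o‖ ^ 2 + 2 * r := by nlinarith
    nlinarith [sq_nonneg (‖c - b‖ - ‖c - o‖ - 1)]
  obtain ⟨a, ha, hab⟩ := hf.exists_mem_MSet_norm_sub_le hlsc he₀ hb₁
  refine ⟨a, ha, ?_⟩
  rw [norm_sub_rev] at hab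
  have h₁ : q (c - a) = q (c - b) + pairing (c - b) (iota (b - a)) + q (b - a) := by
    simp [pairing, iota, q]
    ring
  have h₂ := (le_abs_self _).trans (abs_pairing_iota_le (c - b) (b - a))
  have h₃ := (le_abs_self _).trans (abs_q_le (b - a))
  have h₄ : ‖c - a‖ ≤ ‖c - b‖ + ‖b - a‖ := norm_sub_le_norm_sub_add_norm_sub c b a
  have h₅ : ‖c - a‖ ^ 2 ≤ (‖c - b‖ + ‖b - a‖) ^ 2 := pow_le_pow_left₀ (norm_nonneg _) h₄ 2
  have h₆ : ‖c - b‖ * ‖b - a‖ ≤ R * (4 * e) := by gcongr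
  have h₇ : ‖b - a‖ ^ 2 ≤ (4 * e) ^ 2 := pow_le_pow_left₀ (norm_nonneg _) hab 2
  nlinarith

/-- Every point of the bidual is almost monotonically related to a point where `f` equals `q`. -/
theorem IsVZWith.exists_mem_MSet_qTilde_le [CompleteSpace E] {f : E × StrongDual ℝ E → EReal}
    (hf : IsVZWith (normInfty 1) f) (hlsc : LowerSemicontinuous f)
    (v : StrongDual ℝ (StrongDual ℝ E) × StrongDual ℝ E) {ε : ℝ} (hε : 0 < ε) :
    ∃ a ∈ MSet f, qTilde (v - iota a) < ε := by
  obtain ⟨c, β, hβ, h₁, h₂, hw⟩ := exists_qTilde_sub_iota_le v one_pos (show 0 < ε / 3 by linarith)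
  rw [div_one] at h₁
  rw [one_mul] at h₂
  obtain ⟨a, ha, hca⟩ := hf.exists_mem_MSet_norm_sq_add_q_le hlsc c (show 0 < ε / 3 by linarith)
  refine ⟨a, ha, ?_⟩
  have h₃ : qTilde (v - iota a) =
      qTilde (v - iota c) + pairing (c - a) (v - iota c) + q (c - a) := by
    simp [pairing, iota, q, qTilde]
    ring
  have h₄ : pairing (c - a) (v - iota c) ≤ β * ‖c - a‖ + β * ‖c - a‖ :=
    add_le_add
      ((apply_le_mul _ _).trans (mul_le_mul h₂ (norm_fst_le _) (norm_nonneg _) hβ))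
      ((apply_le_mul _ _).trans (mul_le_mul h₁ (norm_snd_le _) (norm_nonneg _) hβ))
  nlinarith [sq_nonneg (β - ‖c - a‖)]

/-! ### Maximally monotone sets and their Fitzpatrick functions -/

section Monotone

variable {A : Set (E × StrongDual ℝ E)}

theorem IsMaximallyMonotone.q_sub_nonneg (hA : IsMaximallyMonotone A) {a b : E × StrongDual ℝ E}
    (ha : a ∈ A) (hb : b ∈ A) : 0 ≤ q (a - b) :=
  hA.prop a ha b hb

theorem IsMaximallyMonotone.exists_q_sub_neg (hA : IsMaximallyMonotone A) {b : E × StrongDual ℝ E}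
    (hb : b ∉ A) : ∃ a ∈ A, q (b - a) < 0 := by
  by_contra! h
  have hins : IsMonotoneSet (insert b A) := by
    rintro x (rfl | hx) y (rfl | hy)
    · simp
    · exact h y hy
    · have := h x hx
      rw [← q_neg, neg_sub] at this
      exact this
    · exact hA.prop x hx y hy
  exact hb (hA.le_of_ge hins (subset_insert b A) (mem_insert b A))

theorem IsMaximallyMonotone.nonempty (hA : IsMaximallyMonotone A) : A.Nonempty := by
  by_cases h : (0 : E × StrongDual ℝ E) ∈ A
  · exact ⟨_, h⟩
  · obtain ⟨a, ha, -⟩ := hA.exists_q_sub_neg h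
    exact ⟨a, ha⟩

theorem apply_add_apply_eq_pairing_iota (a b : E × StrongDual ℝ E) :
    a.2 b.1 + b.2 a.1 = pairing b (iota a) := by
  simp [pairing, iota]

theorem le_Phi {a : E × StrongDual ℝ E} (ha : a ∈ A) (b : E × StrongDual ℝ E) :
    ((q b - q (b - a) : ℝ) : EReal) ≤ Phi A b := by
  refine le_trans (le_of_eq ?_) (le_iSup₂_of_le a ha le_rfl)
  rw [apply_add_apply_eq_pairing_iota, q_sub]
  congr 1
  ring

theorem Phi_le_coe_iff {b : E × StrongDual ℝ E} {r : ℝ} :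
    Phi A b ≤ r ↔ ∀ a ∈ A, pairing b (iota a) - q a ≤ r := by
  simp only [Phi, iSup_le_iff, EReal.coe_le_coe_iff, apply_add_apply_eq_pairing_iota]

theorem IsMaximallyMonotone.q_le_Phi (hA : IsMaximallyMonotone A) (b : E × StrongDual ℝ E) :
    ((q b : ℝ) : EReal) ≤ Phi A b := by
  by_cases hb : b ∈ A
  · simpa [q] using le_Phi hb b
  · obtain ⟨a, ha, hab⟩ := hA.exists_q_sub_neg hb
    exact le_trans (by exact_mod_cast by linarith) (le_Phi ha b)

theorem IsMaximallyMonotone.Phi_eq_q (hA : IsMaximallyMonotone A) {a : E × StrongDual ℝ E}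
    (ha : a ∈ A) : Phi A a = ((q a : ℝ) : EReal) := by
  refine le_antisymm (Phi_le_coe_iff.2 fun b hb => ?_) (hA.q_le_Phi a)
  have := hA.q_sub_nonneg ha hb
  rw [q_sub] at this
  linarith

theorem IsMaximallyMonotone.MSet_Phi (hA : IsMaximallyMonotone A) : MSet (Phi A) = A := by
  refine Subset.antisymm (fun b hb => ?_) fun a ha => hA.Phi_eq_q ha
  by_contra hbA
  obtain ⟨a, ha, hab⟩ := hA.exists_q_sub_neg hbA
  have h := le_Phi ha b
  rw [show Phi A b = _ from hb, EReal.coe_le_coe_iff] at h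
  linarith

theorem le_Theta {a : E × StrongDual ℝ E} (ha : a ∈ A)
    (v : StrongDual ℝ (StrongDual ℝ E) × StrongDual ℝ E) :
    ((pairing a v - q a : ℝ) : EReal) ≤ Theta A v :=
  le_iSup₂_of_le a ha le_rfl

theorem IsMaximallyMonotone.Theta_ne_bot (hA : IsMaximallyMonotone A)
    (v : StrongDual ℝ (StrongDual ℝ E) × StrongDual ℝ E) : Theta A v ≠ ⊥ := by
  obtain ⟨a, ha⟩ := hA.nonempty
  exact ne_bot_of_le_ne_bot (EReal.coe_ne_bot _) (le_Theta ha v)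

theorem Theta_iota (a : E × StrongDual ℝ E) : Theta A (iota a) = Phi A a := by
  simp only [Theta, Phi, apply_add_apply_eq_pairing_iota, pairing_iota_comm a]

theorem starTheta_le_coe_iff {b : E × StrongDual ℝ E} {r : ℝ} :
    starTheta A b ≤ r ↔ ∀ v, ((pairing b v - r : ℝ) : EReal) ≤ Theta A v := by
  simp only [starTheta, iSup_le_iff, coe_sub_le_coe_iff]

theorem starTheta_le_q {a : E × StrongDual ℝ E} (ha : a ∈ A) :
    starTheta A a ≤ ((q a : ℝ) : EReal) :=
  starTheta_le_coe_iff.2 (le_Theta ha)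

theorem IsMaximallyMonotone.Phi_le_starTheta (hA : IsMaximallyMonotone A)
    (b : E × StrongDual ℝ E) : Phi A b ≤ starTheta A b := by
  refine iSup₂_le fun a ha => le_iSup_of_le (iota a) ?_
  rw [Theta_iota, hA.Phi_eq_q ha, apply_add_apply_eq_pairing_iota, EReal.coe_sub]

theorem IsMaximallyMonotone.MSet_starTheta (hA : IsMaximallyMonotone A) :
    MSet (starTheta A) = A := by
  refine Subset.antisymm (fun b hb => ?_) fun a ha => ?_
  · rw [← hA.MSet_Phi]
    exact le_antisymm ((hA.Phi_le_starTheta b).trans hb.le) (hA.q_le_Phi b)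
  · exact le_antisymm (starTheta_le_q ha) ((hA.q_le_Phi a).trans (hA.Phi_le_starTheta a))

theorem IsMaximallyMonotone.isProperConvexLSC_Phi (hA : IsMaximallyMonotone A) :
    IsProperConvexLSC (Phi A) where
  toIsProperConvex := by
    refine isProperConvex_of_le_combination
      (fun b => ne_bot_of_le_ne_bot (EReal.coe_ne_bot _) (hA.q_le_Phi b)) ?_ ?_
    · obtain ⟨a, ha⟩ := hA.nonempty
      exact ⟨a, by simp [hA.Phi_eq_q ha]⟩
    · intro x y s t r u hs ht hst hx hy
      rw [Phi_le_coe_iff] at hx hy ⊢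
      intro a ha
      have e : pairing (s • x + t • y) (iota a) - q a =
          s * (pairing x (iota a) - q a) + t * (pairing y (iota a) - q a) := by
        simp [pairing, iota]
        linear_combination q a * hst
      rw [e]
      gcongr
      exacts [hx a ha, hy a ha]
  lsc := by
    refine lowerSemicontinuous_biSup fun a _ => Continuous.lowerSemicontinuous ?_
    exact continuous_coe_real_ereal.comp (by fun_prop)

theorem IsMaximallyMonotone.isProperConvexLSC_starTheta (hA : IsMaximallyMonotone A) :
    IsProperConvexLSC (starTheta A) where
  toIsProperConvex := by
    refine isProperConvex_of_le_combination (fun b => ne_bot_of_le_ne_bot (EReal.coe_ne_bot _)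
      ((hA.q_le_Phi b).trans (hA.Phi_le_starTheta b))) ?_ ?_
    · obtain ⟨a, ha⟩ := hA.nonempty
      exact ⟨a, ne_top_of_le_ne_top (EReal.coe_ne_top _) (starTheta_le_q ha)⟩
    · intro x y s t r u hs ht hst hx hy
      rw [starTheta_le_coe_iff] at hx hy ⊢
      intro v
      refine coe_le_of_forall_le (hA.Theta_ne_bot v) fun θ hθ => ?_
      have hx' : pairing x v - r ≤ θ := by exact_mod_cast (hx v).trans hθ
      have hy' : pairing y v - u ≤ θ := by exact_mod_cast (hy v).trans hθ
      have e : pairing (s • x + t • y) v - (s * r + t * u) =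
          s * (pairing x v - r) + t * (pairing y v - u) := by
        simp [pairing]
        ring
      calc _ = s * (pairing x v - r) + t * (pairing y v - u) := e
        _ ≤ s * θ + t * θ := by gcongr
        _ = θ := by rw [← add_mul, hst, one_mul]
  lsc := by
    refine lowerSemicontinuous_iSup fun v => Continuous.lowerSemicontinuous ?_
    induction hv : Theta A v with
    | bot => exact absurd hv (hA.Theta_ne_bot v)
    | top => simpa using continuous_const
    | coe θ =>
      have := continuous_pairing_left v
      simp only [← EReal.coe_sub]
      exact continuous_coe_real_ereal.comp (by fun_prop)

theorem conj_anti {f g : E × StrongDual ℝ E → EReal} (h : ∀ b, f b ≤ g b)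
    (v : StrongDual ℝ (StrongDual ℝ E) × StrongDual ℝ E) : conj g v ≤ conj f v :=
  iSup_mono fun b => EReal.sub_le_sub le_rfl (h b)

theorem IsMaximallyMonotone.conj_starTheta (hA : IsMaximallyMonotone A)
    (v : StrongDual ℝ (StrongDual ℝ E) × StrongDual ℝ E) :
    conj (starTheta A) v = Theta A v := by
  refine le_antisymm ?_ (iSup₂_le fun a ha => le_iSup_of_le a ?_)
  · induction hv : Theta A v with
    | bot => exact absurd hv (hA.Theta_ne_bot v)
    | top => exact le_top
    | coe θ =>
      refine conj_le_coe_iff.2 fun b => le_iSup_of_le v ?_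
      rw [hv, EReal.coe_sub]
  · rw [EReal.coe_sub]
    exact EReal.sub_le_sub le_rfl (starTheta_le_q ha)

/-- A convex function above `q` dominates the Fitzpatrick function of its coincidence set: near
`a` on the segment from `a` to `b`, convexity bounds `q` from above and its derivative at `a` in
the direction `b - a` gives the affine term belonging to `a`. -/
theorem IsProperConvex.Phi_MSet_le {f : E × StrongDual ℝ E → EReal} (hf : IsProperConvex f)
    (hq : ∀ b, ((q b : ℝ) : EReal) ≤ f b) (b : E × StrongDual ℝ E) :
    Phi (MSet f) b ≤ f b := by
  refine iSup₂_le fun a ha => coe_le_of_forall_le (hf.ne_bot b) fun t ht => ?_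
  rw [apply_add_apply_eq_pairing_iota]
  have hseg : ∀ s : ℝ, 0 < s → s < 1 →
      (1 - s) * (pairing b (iota a) - q a) + s * q b ≤ t := by
    intro s hs hs'
    have h := (hq _).trans (hf.le_combination hs (sub_pos.2 hs') (by ring) ht (le_of_eq ha))
    rw [EReal.coe_le_coe_iff, q_combination] at h
    refine le_of_mul_le_mul_left ?_ hs
    linarith
  have hlim : Tendsto (fun s : ℝ => (1 - s) * (pairing b (iota a) - q a) + s * q b) (𝓝[>] 0)
      (𝓝 (pairing b (iota a) - q a)) := by
    have : Continuous fun s : ℝ => (1 - s) * (pairing b (iota a) - q a) + s * q b := by fun_prop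
    simpa using (this.tendsto 0).mono_left nhdsWithin_le_nhds
  refine le_of_tendsto hlim ?_
  filter_upwards [Ioo_mem_nhdsGT (zero_lt_one' ℝ)] with s hs
  exact hseg s hs.1 hs.2

theorem isTypeNI_iff :
    IsTypeNI A ↔ ∀ v (ε : ℝ), 0 < ε → ∃ a ∈ A, qTilde (v - iota a) < ε := by
  refine forall_congr' fun v => ⟨fun h ε hε => ?_, fun h => ?_⟩
  · simpa [iInf_lt_iff] using h.trans_lt (EReal.coe_pos.2 hε)
  · refine EReal.le_of_forall_lt_iff_le.1 fun ε hε => ?_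
    obtain ⟨a, ha, hlt⟩ := h ε (EReal.coe_pos.1 hε)
    exact iInf₂_le_of_le a ha (by exact_mod_cast hlt.le)

theorem IsMaximallyMonotone.isTypeNI_iff_qTilde_le_Theta (hA : IsMaximallyMonotone A) :
    IsTypeNI A ↔ ∀ v, ((qTilde v : ℝ) : EReal) ≤ Theta A v := by
  simp only [isTypeNI_iff, qTilde_sub_iota]
  refine forall_congr' fun v => ⟨fun h => ?_, fun h ε hε => ?_⟩
  · refine coe_le_of_forall_le (hA.Theta_ne_bot v) fun t ht => le_of_forall_pos_lt_add fun ε hε => ?_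
    obtain ⟨a, ha, hlt⟩ := h ε hε
    have : pairing a v - q a ≤ t := by exact_mod_cast (le_Theta ha v).trans ht
    linarith
  · have hlt : ((qTilde v - ε : ℝ) : EReal) < Theta A v :=
      (EReal.coe_lt_coe (sub_lt_self _ hε)).trans_le h
    obtain ⟨a, ha, hlt⟩ := lt_biSup_iff.1 hlt
    refine ⟨a, ha, ?_⟩
    have : qTilde v - ε < pairing a v - q a := by exact_mod_cast hlt
    linarith

/-- The step from `Φ_A* ≥ q̃` to type (NI): `Φ_A` is then a lower semicontinuous VZ function whose
coincidence set is `A`. -/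
theorem IsMaximallyMonotone.isTypeNI_of_qTilde_le_conj_Phi [CompleteSpace E]
    (hA : IsMaximallyMonotone A) (h : ∀ v, ((qTilde v : ℝ) : EReal) ≤ conj (Phi A) v) :
    IsTypeNI A := by
  have hPhi := hA.isProperConvexLSC_Phi
  have hVZ := isVZAll_of_le_of_le_conj hPhi.toIsProperConvex hA.q_le_Phi h _
    (isSpecialNorm_normInfty one_pos)
  refine isTypeNI_iff.2 fun v ε hε => ?_
  have := hVZ.exists_mem_MSet_qTilde_le hPhi.lsc v hε
  rwa [hA.MSet_Phi] at this

end Monotone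

end SSD

end

theorem theorem5p8 {E : Type*} [NormedAddCommGroup E] [NormedSpace ℝ E] [CompleteSpace E]
    [Nontrivial E] (A : Set (E × StrongDual ℝ E)) (hA : SSD.IsMaximallyMonotone A) :
    List.TFAE [
      -- (a)
      SSD.IsTypeNI A,
      -- (b)
      ∀ c, ((SSD.qTilde c : ℝ) : EReal) ≤ SSD.Theta A c,
      -- (c)
      ∀ c, ((SSD.qTilde c : ℝ) : EReal) ≤ SSD.conj (SSD.Phi A) c,
      -- (d)
      SSD.IsStronglyRepresentable A,
      -- (e), with respect to some and to every special norm
      ∃ f : E × StrongDual ℝ E → EReal, LowerSemicontinuous f ∧ SSD.IsVZ f ∧ SSD.MSet f = A,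
      ∃ f : E × StrongDual ℝ E → EReal, LowerSemicontinuous f ∧ SSD.IsVZAll f ∧ SSD.MSet f = A,
      -- (f), with respect to some and to every special norm
      SSD.IsVZ (SSD.Phi A),
      SSD.IsVZAll (SSD.Phi A),
      -- (g), with respect to some and to every special norm
      SSD.IsVZ (SSD.starTheta A),
      SSD.IsVZAll (SSD.starTheta A),
      -- (b₁)
      ∀ h : E × StrongDual ℝ E → EReal, SSD.IsProperConvex h →
        (∀ b, h b ≤ SSD.starTheta A b) →
        ∀ c, ((SSD.qTilde c : ℝ) : EReal) ≤ SSD.conj h c,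
      -- (b₂)
      ∀ h : E × StrongDual ℝ E → EReal, SSD.IsProperConvexLSC h →
        (∀ b, h b ≤ SSD.starTheta A b) → (∀ b, SSD.Phi A b ≤ h b) →
        ∀ c, ((SSD.qTilde c : ℝ) : EReal) ≤ SSD.conj h c,
      -- (c₁)
      ∃ h : E × StrongDual ℝ E → EReal, SSD.IsProperConvexLSC h ∧
        (∀ b, h b ≤ SSD.starTheta A b) ∧ (∀ b, SSD.Phi A b ≤ h b) ∧
        ∀ c, ((SSD.qTilde c : ℝ) : EReal) ≤ SSD.conj h c,
      -- (c₂)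
      ∃ h : E × StrongDual ℝ E → EReal, SSD.IsProperConvex h ∧
        (∀ b, SSD.Phi A b ≤ h b) ∧
        ∀ c, ((SSD.qTilde c : ℝ) : EReal) ≤ SSD.conj h c] := by
  have hPhi := hA.isProperConvexLSC_Phi
  have hTheta := hA.isProperConvexLSC_starTheta
  have hq (b) : ((SSD.q b : ℝ) : EReal) ≤ SSD.starTheta A b :=
    (hA.q_le_Phi b).trans (hA.Phi_le_starTheta b)
  tfae_have 1 ↔ 2 := hA.isTypeNI_iff_qTilde_le_Theta
  tfae_have 2 → 11 := fun h f _ hf c =>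
    (h c).trans ((hA.conj_starTheta c).ge.trans (SSD.conj_anti hf c))
  tfae_have 11 → 12 := fun h f hf hle _ => h f hf.toIsProperConvex hle
  tfae_have 12 → 13 := fun h => ⟨SSD.starTheta A, hTheta, fun _ => le_rfl, hA.Phi_le_starTheta,
    h _ hTheta (fun _ => le_rfl) hA.Phi_le_starTheta⟩
  tfae_have 13 → 14 := fun ⟨f, hf, _, hle, hc⟩ => ⟨f, hf.toIsProperConvex, hle, hc⟩
  tfae_have 14 → 3 := fun ⟨_, _, hle, hc⟩ c => (hc c).trans (SSD.conj_anti hle c)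
  tfae_have 3 → 1 := hA.isTypeNI_of_qTilde_le_conj_Phi
  tfae_have 2 → 4 := fun h =>
    ⟨SSD.starTheta A, hTheta, hq, fun c => (h c).trans (hA.conj_starTheta c).ge, hA.MSet_starTheta⟩
  tfae_have 4 → 14 := by
    rintro ⟨f, hf, hqf, hc, rfl⟩
    exact ⟨f, hf.toIsProperConvex, hf.toIsProperConvex.Phi_MSet_le hqf, hc⟩
  tfae_have 4 → 6 := fun ⟨f, hf, hqf, hc, hM⟩ =>
    ⟨f, hf.lsc, SSD.isVZAll_of_le_of_le_conj hf.toIsProperConvex hqf hc, hM⟩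
  tfae_have 6 → 5 := fun ⟨f, hlsc, hf, hM⟩ => ⟨f, hlsc, hf.isVZ, hM⟩
  tfae_have 5 → 4 := fun ⟨f, hlsc, ⟨_, hN, hf⟩, hM⟩ =>
    ⟨f, ⟨hf.1, hlsc⟩, hf.q_le hN, hf.qTilde_le_conj hN, hM⟩
  tfae_have 3 → 8 := SSD.isVZAll_of_le_of_le_conj hPhi.toIsProperConvex hA.q_le_Phi
  tfae_have 8 → 7 := SSD.IsVZAll.isVZ
  tfae_have 7 → 3 := fun ⟨_, hN, hf⟩ => hf.qTilde_le_conj hN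
  tfae_have 2 → 10 := fun h => SSD.isVZAll_of_le_of_le_conj hTheta.toIsProperConvex hq
    fun c => (h c).trans (hA.conj_starTheta c).ge
  tfae_have 10 → 9 := SSD.IsVZAll.isVZ
  tfae_have 9 → 2 := fun ⟨_, hN, hf⟩ c => (hf.qTilde_le_conj hN c).trans (hA.conj_starTheta c).le
  tfae_finish
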